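/- Let $G$ be a just infinite profinite group, that is, an infinite profinite group in which every non-trivial closed normal subgroup has finite index. Then the open normal subgroups of $G$ fall into infinitely many isomorphism classes (as topological groups) if and only if $G$ is not virtually abelian, i.e. if and only if $G$ has no closed abelian subgroup of finite index. -/

import Mathlib

/-- A profinite group is just infinite if it is infinite and every non-trivial closed normal
subgroup has finite index. -/
def IsJustInfinite (G : Type*) [Group G] [TopologicalSpace G] : Prop :=
  Infinite G ∧
    ∀ N : Subgroup G, N.Normal → IsClosed (N : Set G) → N ≠ ⊥ → N.FiniteIndex

/-- A profinite group is virtually abelian if it has a closed abelian subgroup of finite index. -/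
def IsVirtuallyAbelian (G : Type*) [Group G] [TopologicalSpace G] : Prop :=
  ∃ A : Subgroup G, IsClosed (A : Set G) ∧ A.FiniteIndex ∧ ∀ x ∈ A, ∀ y ∈ A, x * y = y * x

/-- Two open normal subgroups are equivalent if they are isomorphic as topological groups. -/
def openNormalIsoSetoid (G : Type*) [Group G] [TopologicalSpace G] :
    Setoid (OpenNormalSubgroup G) where
  r M N := Nonempty (M.toSubgroup ≃ₜ* N.toSubgroup)
  iseqv :=
    { refl := fun M => ⟨ContinuousMulEquiv.refl M.toSubgroup⟩
      symm := fun ⟨e⟩ => ⟨e.symm⟩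
      trans := fun ⟨e⟩ ⟨f⟩ => ⟨e.trans f⟩ }

/-- The isomorphism types (as topological groups) of open normal subgroups of `G`. -/
abbrev OpenNormalIsoType (G : Type*) [Group G] [TopologicalSpace G] : Type _ :=
  Quotient (openNormalIsoSetoid G)

/-!
Let `G` be a just infinite profinite group. Both implications rest on a finiteness property
(`IsJustInfinite.finite_not_le`): an open subgroup of `G` contains all but finitely many closed
normal subgroups. By compactness, the closed normal subgroups not contained in a given open subgroup
satisfy the descending chain condition (`IsJustInfinite.isWF_not_le`), and below a closed normal
subgroup `N` there are only finitely many maximal ones, since otherwise `N` would be an infinite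
product of chief factors and `G` would have a non-trivial finite normal subgroup
(`IsJustInfinite.sInf_maximalNormalBelow_ne_bot`). A König-type argument combines the two.

Suppose that there are finitely many isomorphism types. One of them contains infinitely many open
normal subgroups. For each `n`, the intersection of the open subgroups of index at most `n` of a
member `N` is topologically characteristic in `N`, and open, because `G` has only finitely many open
normal subgroups of bounded index. So `G` acts by conjugation on a finite quotient of `N` whose
order does not depend on `N`, and one open subgroup of `G` lies in the kernels of all these actions. It
contains some member of the class, whose finite quotient is therefore abelian; then so is that of
every member. As `n` varies these quotients separate points, so the members are abelian
(`IsJustInfinite.commute_of_infinite_class`).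

Conversely, let `A` be an open normal abelian subgroup. It is torsion-free, since a torsion element
has finitely many conjugates and these generate a finite normal subgroup. So taking powers embeds
`A` into itself, and for some `n` the subgroup `A ^ n` is proper. Every open normal `N ≤ A` is the
group of `n ^ k`-th powers of an isomorphic open normal subgroup of `A` not contained in `A ^ n`,
and there are finitely many of the latter (`IsJustInfinite.finite_of_isVirtuallyAbelian`). No
classification of `A` as a free `ℤ_[p]`-module is needed.
-/

/-! ### Subgroups of finite index and open subgroups -/

theorem Subgroup.finite_setOf_ge_of_finiteIndex {G : Type*} [Group G] (L : Subgroup G)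
    [L.FiniteIndex] : {H : Subgroup G | L ≤ H}.Finite := by
  refine Set.Finite.of_finite_image (f := fun H : Subgroup G => (QuotientGroup.mk '' (H : Set G) :
    Set (G ⧸ L))) (Set.toFinite _) ?_
  have key : ∀ H K : Subgroup G, L ≤ K →
      (QuotientGroup.mk '' (H : Set G) : Set (G ⧸ L)) ⊆ QuotientGroup.mk '' (K : Set G) →
      H ≤ K := by
    intro H K hK h x hx
    obtain ⟨y, hy, hxy⟩ := h ⟨x, hx, rfl⟩
    have := K.mul_mem hy (hK (QuotientGroup.eq.1 hxy))
    simpa using this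
  intro H hH K hK h
  exact le_antisymm (key H K hK h.le) (key K H hH h.ge)

theorem Subgroup.ne_bot_of_not_le {G : Type*} [Group G] {N H : Subgroup G} (h : ¬ N ≤ H) :
    N ≠ ⊥ := by
  rintro rfl
  exact h bot_le

section Profinite

variable {G : Type*} [Group G] [TopologicalSpace G] [IsTopologicalGroup G] [CompactSpace G]

theorem Subgroup.finiteIndex_of_isOpen {H : Subgroup G} (h : IsOpen (H : Set G)) :
    H.FiniteIndex := by
  have := H.quotient_finite_of_isOpen h
  exact H.finiteIndex_of_finite_quotient

theorem Subgroup.isOpen_normalCore {H : Subgroup G} (h : IsOpen (H : Set G)) :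
    IsOpen (H.normalCore : Set G) := by
  have := Subgroup.finiteIndex_of_isOpen h
  exact Subgroup.isOpen_of_isClosed_of_finiteIndex _
    (H.normalCore_isClosed (H.isClosed_of_isOpen h))

theorem Subgroup.index_normalCore_le {G : Type*} [Group G] (H : Subgroup G) [H.FiniteIndex] :
    H.normalCore.index ≤ H.index.factorial := by
  rw [Subgroup.normalCore_eq_ker, Subgroup.index_ker, Subgroup.index, ← Nat.card_perm]
  exact Nat.card_le_card_of_injective _ Subtype.val_injective

variable [TotallyDisconnectedSpace G]

theorem exists_openNormalSubgroup_disjoint_of_finite {S : Set G} (hS : S.Finite)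
    (h1 : (1 : G) ∉ S) : ∃ U : OpenNormalSubgroup G, ∀ x ∈ S, x ∉ U := by
  obtain ⟨U, hU⟩ := ProfiniteGrp.exist_openNormalSubgroup_sub_open_nhds_of_one
    (U := Sᶜ) hS.isClosed.isOpen_compl h1
  exact ⟨U, fun x hx hxU => hU hxU hx⟩

theorem exists_openNormalSubgroup_notMem {x : G} (hx : x ≠ 1) :
    ∃ U : OpenNormalSubgroup G, x ∉ U := by
  obtain ⟨U, hU⟩ := exists_openNormalSubgroup_disjoint_of_finite (Set.finite_singleton x)
    (by simpa using hx.symm)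
  exact ⟨U, hU x rfl⟩

/-- Choose `m + 1` elements of `G`; an open normal subgroup missing the non-trivial quotients of
these elements separates their cosets. -/
theorem exists_openNormalSubgroup_lt_index [Infinite G] (m : ℕ) :
    ∃ U : OpenNormalSubgroup G, m < U.toSubgroup.index := by
  obtain ⟨t, ht⟩ := Infinite.exists_subset_card_eq G (m + 1)
  obtain ⟨U, hU⟩ := exists_openNormalSubgroup_disjoint_of_finite
    (S := (fun p : G × G => p.1⁻¹ * p.2) '' ((t : Set G) ×ˢ (t : Set G)) \ {1})
    (((t.finite_toSet.prod t.finite_toSet).image _).sdiff) (by simp)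
  refine ⟨U, ?_⟩
  have := U.toSubgroup.quotient_finite_of_isOpen U.isOpen
  have hinj : Function.Injective (fun x : t => (QuotientGroup.mk (x : G) : G ⧸ U.toSubgroup)) := by
    intro x y hxy
    by_contra hne
    refine hU _ ⟨⟨(x, y), ⟨x.2, y.2⟩, rfl⟩, ?_⟩ (QuotientGroup.eq.1 hxy)
    simpa [inv_mul_eq_one] using fun h => hne (Subtype.ext h)
  have := Nat.card_le_card_of_injective _ hinj
  rw [Nat.card_eq_fintype_card, Fintype.card_coe, ht] at this
  exact this

end Profinite

/-! ### Almost all normal subgroups lie in a given open subgroup -/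

section JustInfinite

variable {G : Type*} [Group G] [TopologicalSpace G] [IsTopologicalGroup G]

theorem IsJustInfinite.isOpen (hG : IsJustInfinite G) {N : Subgroup G} (hn : N.Normal)
    (hc : IsClosed (N : Set G)) (hb : N ≠ ⊥) : IsOpen (N : Set G) := by
  have := hG.2 N hn hc hb
  exact N.isOpen_of_isClosed_of_finiteIndex hc

/-- The maximal elements among the open normal subgroups of `G` properly contained in `N`. -/
abbrev maximalNormalBelow (N : Subgroup G) : Set (Subgroup G) :=
  {M | Maximal (fun M : Subgroup G => M.Normal ∧ IsOpen (M : Set G) ∧ M < N) M}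

theorem sup_eq_of_mem_maximalNormalBelow {N M C : Subgroup G} (hM : M ∈ maximalNormalBelow N)
    (hCn : C.Normal) (hCN : C ≤ N) (hCM : ¬ C ≤ M) : C ⊔ M = N := by
  have := hM.1.1
  by_contra hne
  exact hCM (le_sup_left.trans (hM.2 ⟨inferInstance,
    Subgroup.isOpen_mono le_sup_right hM.1.2.1,
    lt_of_le_of_ne (sup_le hCN hM.1.2.2.le) hne⟩ le_sup_right))

variable [CompactSpace G]

theorem not_isOpen_bot_of_infinite [Infinite G] : ¬ IsOpen ((⊥ : Subgroup G) : Set G) := by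
  intro h
  have := Subgroup.finiteIndex_of_isOpen h
  exact this.index_ne_zero (by rw [Subgroup.index_bot, Nat.card_eq_zero_of_infinite])

theorem IsJustInfinite.ne_bot_of_isOpen (hG : IsJustInfinite G) {N : Subgroup G}
    (h : IsOpen (N : Set G)) : N ≠ ⊥ := by
  have := hG.1
  rintro rfl
  exact not_isOpen_bot_of_infinite h

/-- The intersection of a descending sequence of closed normal subgroups not contained in `H` is,
by compactness, not contained in `H`. Hence it is non-trivial, of finite index, and the sequence
is eventually constant. -/
theorem IsJustInfinite.isWF_not_le {G : Type*} [Group G] [TopologicalSpace G]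
    [CompactSpace G] (hG : IsJustInfinite G) {H : Subgroup G}
    (hH : IsOpen (H : Set G)) :
    {N : Subgroup G | N.Normal ∧ IsClosed (N : Set G) ∧ ¬ N ≤ H}.IsWF := by
  rw [Set.isWF_iff_no_descending_seq]
  intro f hf hmem
  have hne : (⋂ i, ((f i : Set G) \ H)).Nonempty := by
    refine IsCompact.nonempty_iInter_of_sequence_nonempty_isCompact_isClosed _ (fun i => ?_)
      (fun i => ?_) ?_ (fun i => ?_)
    · exact Set.sdiff_subset_sdiff_left (hf.antitone (Nat.le_succ i))
    · exact Set.not_subset.1 (hmem i).2.2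
    · exact ((hmem 0).2.1.sdiff hH).isCompact
    · exact (hmem i).2.1.sdiff hH
  obtain ⟨x, hx⟩ := hne
  rw [Set.mem_iInter] at hx
  have hL : (⨅ i, f i).FiniteIndex := by
    refine hG.2 _ (Subgroup.normal_iInf_normal fun i => (hmem i).1) ?_ ?_
    · rw [Subgroup.coe_iInf]
      exact isClosed_iInter fun i => (hmem i).2.1
    · exact Subgroup.ne_bot_of_not_le fun h =>
        (hx 0).2 (h (Subgroup.mem_iInf.2 fun i => (hx i).1))
  exact Set.infinite_range_of_injective hf.injective
    ((Subgroup.finite_setOf_ge_of_finiteIndex (⨅ i, f i)).subset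
      (Set.range_subset_iff.2 fun i => iInf_le f i))

/-- If the maximal elements intersected trivially, `N` would be a semisimple `G`-group. A closed
normal subgroup `C ≤ N` minimal subject to not lying in a fixed maximal element `M₁` would then
meet `M₁` trivially, which is absurd since both are open in the infinite group `G`. -/
theorem IsJustInfinite.sInf_maximalNormalBelow_ne_bot (hG : IsJustInfinite G) {N : Subgroup G}
    (hn : N.Normal) (hc : IsClosed (N : Set G)) (hN : N ≠ ⊥) :
    sInf (maximalNormalBelow N) ≠ ⊥ := by
  intro hbot
  have hne : (maximalNormalBelow N).Nonempty := by
    by_contra h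
    rw [Set.not_nonempty_iff_eq_empty.1 h, sInf_empty] at hbot
    exact hN (le_bot_iff.1 (le_top.trans hbot.le))
  obtain ⟨M₁, hM₁⟩ := hne
  have := hM₁.1.1
  obtain ⟨C, ⟨⟨hCn, hCc, hCM⟩, hCN⟩, hmin⟩ := Set.WellFoundedOn.exists_minimal
    (s := {C : Subgroup G | (C.Normal ∧ IsClosed (C : Set G) ∧ ¬ C ≤ M₁) ∧ C ≤ N})
    ((hG.isWF_not_le hM₁.1.2.1).mono fun _ h => h.1)
    ⟨N, ⟨hn, hc, hM₁.1.2.2.not_ge⟩, le_rfl⟩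
  have hDne : C ⊓ M₁ ≠ ⊥ := hG.ne_bot_of_isOpen (by
    rw [Subgroup.coe_inf]
    exact (hG.isOpen hCn hCc (Subgroup.ne_bot_of_not_le hCM)).inter hM₁.1.2.1)
  obtain ⟨M₂, hM₂, hDM⟩ : ∃ M₂ ∈ maximalNormalBelow N, ¬ C ⊓ M₁ ≤ M₂ := by
    by_contra! h
    exact hDne (le_bot_iff.1 (hbot ▸ le_sInf h))
  have := hM₂.1.1
  have hsup := sup_eq_of_mem_maximalNormalBelow hM₂ (C := C ⊓ M₁) inferInstance
    (inf_le_left.trans hCN) hDM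
  -- By the modular law `C = (C ⊓ M₁) ⊔ (C ⊓ M₂)`, so `C ⊓ M₂` inherits the property of `C`.
  have hCM₂ : ¬ C ⊓ M₂ ≤ M₁ := by
    intro h
    refine hCM fun x hx => ?_
    obtain ⟨d, hd, m, hm, rfl⟩ := Subgroup.mem_sup_of_normal_right.1 (hsup.ge (hCN hx))
    exact M₁.mul_mem hd.2 (h ⟨(C.mul_mem_cancel_left hd.1).1 hx, hm⟩)
  refine hDM (inf_le_left.trans ((hmin ⟨⟨inferInstance, ?_, hCM₂⟩, inf_le_left.trans hCN⟩
    inf_le_left).trans inf_le_right))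
  rw [Subgroup.coe_inf]
  exact hCc.inter (M₂.isClosed_of_isOpen hM₂.1.2.1)

theorem IsJustInfinite.finite_maximalNormalBelow (hG : IsJustInfinite G) {N : Subgroup G}
    (hn : N.Normal) (hc : IsClosed (N : Set G)) (hN : N ≠ ⊥) :
    (maximalNormalBelow N).Finite := by
  have : (sInf (maximalNormalBelow N)).FiniteIndex := by
    refine hG.2 _ ?_ ?_ (hG.sInf_maximalNormalBelow_ne_bot hn hc hN)
    · rw [sInf_eq_iInf']
      exact Subgroup.normal_iInf_normal fun M => M.2.1.1
    · rw [Subgroup.coe_sInf]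
      exact isClosed_biInter fun M hM => M.isClosed_of_isOpen hM.1.2.1
  exact (Subgroup.finite_setOf_ge_of_finiteIndex _).subset fun M hM => sInf_le hM

/-- In a just infinite profinite group, an open subgroup contains all but finitely many
closed normal subgroups. Otherwise choose `N` minimal among the closed normal subgroups having
infinitely many closed normal subgroups not contained in `H` below them. The proper ones among
these lie below the finitely many maximal elements below `N`, contradicting minimality. -/
theorem IsJustInfinite.finite_not_le (hG : IsJustInfinite G) {H : Subgroup G}
    (hH : IsOpen (H : Set G)) :
    {N : Subgroup G | N.Normal ∧ IsClosed (N : Set G) ∧ ¬ N ≤ H}.Finite := by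
  set K := {N : Subgroup G | N.Normal ∧ IsClosed (N : Set G) ∧ ¬ N ≤ H} with hK
  by_contra hinf
  obtain ⟨M, hM⟩ := (show K.Infinite from hinf).nonempty
  obtain ⟨N, ⟨hNK, hNinf⟩, hmin⟩ := Set.WellFoundedOn.exists_minimal
    (s := {N | N ∈ K ∧ (K ∩ Set.Iic N).Infinite})
    ((hG.isWF_not_le hH).mono fun _ h => h.1)
    ⟨⊤, ⟨inferInstance, isClosed_univ, fun h => hM.2.2 (le_top.trans h)⟩, by
      simpa [Set.Iic_top] using hinf⟩
  have hfin := hG.finite_maximalNormalBelow hNK.1 hNK.2.1 (Subgroup.ne_bot_of_not_le hNK.2.2)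
  refine hNinf (((Set.finite_singleton N).union (hfin.biUnion
    (t := fun M => K ∩ Set.Iic M) fun M hM => ?_)).subset ?_)
  · by_contra hMinf
    obtain ⟨P, hP, hPM⟩ := (show (K ∩ Set.Iic M).Infinite from hMinf).nonempty
    exact hM.1.2.2.not_ge (hmin ⟨⟨hM.1.1, M.isClosed_of_isOpen hM.1.2.1,
      fun h => hP.2.2 (le_trans hPM h)⟩, hMinf⟩ hM.1.2.2.le)
  · rintro P ⟨hP, hPN⟩
    rcases eq_or_lt_of_le (Set.mem_Iic.1 hPN) with rfl | hlt
    · exact Or.inl rfl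
    right
    have hPo := hG.isOpen hP.1 hP.2.1 (Subgroup.ne_bot_of_not_le hP.2.2)
    have := Subgroup.finiteIndex_of_isOpen hPo
    obtain ⟨M, hPM, hM⟩ := Set.Finite.exists_le_maximal
      (s := {M : Subgroup G | P ≤ M ∧ M.Normal ∧ IsOpen (M : Set G) ∧ M < N})
      ((Subgroup.finite_setOf_ge_of_finiteIndex P).subset fun _ h => h.1)
      ⟨le_rfl, hP.1, hPo, hlt⟩
    refine Set.mem_biUnion (x := M) ⟨hM.1.2, fun Q hQ hMQ => hM.2 ⟨hPM.trans hMQ, hQ⟩ hMQ⟩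
      ⟨hP, hPM⟩

end JustInfinite

/-! ### Isomorphic open normal subgroups -/

section OpenIndexLE

/-- The intersection of all open subgroups of index at most `n`; here, as for `Subgroup.index`,
infinite index counts as index `0`. On compact groups, the case of interest, open subgroups have
finite index. -/
def infOpenIndexLE (H : Type*) [Group H] [TopologicalSpace H] (n : ℕ) : Subgroup H :=
  sInf {P : Subgroup H | IsOpen (P : Set H) ∧ P.index ≤ n}

theorem infOpenIndexLE_le {H : Type*} [Group H] [TopologicalSpace H] {n : ℕ} {P : Subgroup H}
    (ho : IsOpen (P : Set H)) (hi : P.index ≤ n) : infOpenIndexLE H n ≤ P :=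
  sInf_le ⟨ho, hi⟩

theorem infOpenIndexLE_le_comap {H H' : Type*} [Group H] [TopologicalSpace H] [Group H']
    [TopologicalSpace H'] (e : H ≃ₜ* H') (n : ℕ) :
    infOpenIndexLE H n ≤ (infOpenIndexLE H' n).comap (e : H →* H') := by
  intro x hx
  refine Subgroup.mem_comap.2 (Subgroup.mem_sInf.2 fun P hP => ?_)
  refine infOpenIndexLE_le (P := P.comap (e : H →* H')) (hP.1.preimage e.continuous) ?_ hx
  rw [Subgroup.index_comap_of_surjective _ e.surjective]
  exact hP.2

theorem comap_infOpenIndexLE {H H' : Type*} [Group H] [TopologicalSpace H] [Group H']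
    [TopologicalSpace H'] (e : H ≃ₜ* H') (n : ℕ) :
    (infOpenIndexLE H' n).comap (e : H →* H') = infOpenIndexLE H n := by
  refine le_antisymm (fun x hx => ?_) (infOpenIndexLE_le_comap e n)
  have := infOpenIndexLE_le_comap e.symm n hx
  simpa using this

theorem index_infOpenIndexLE_congr {H H' : Type*} [Group H] [TopologicalSpace H] [Group H']
    [TopologicalSpace H'] (e : H ≃ₜ* H') (n : ℕ) :
    (infOpenIndexLE H n).index = (infOpenIndexLE H' n).index := by
  rw [← comap_infOpenIndexLE e, Subgroup.index_comap_of_surjective _ e.surjective]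

variable {G : Type*} [Group G] [TopologicalSpace G] [IsTopologicalGroup G]

/-- Conjugation by `g` on a normal subgroup, as an isomorphism of topological groups. -/
def conjNormalContinuousMulEquiv (N : Subgroup G) [N.Normal] (g : G) : N ≃ₜ* N :=
  { (MulAut.conjNormal g : MulAut N) with
    continuous_toFun := by
      refine Continuous.subtype_mk (f := fun x : N => g * x * g⁻¹) (by fun_prop) _
    continuous_invFun := by
      refine Continuous.subtype_mk (f := fun x : N => g⁻¹ * x * g⁻¹⁻¹) (by fun_prop) _ }

instance normal_map_infOpenIndexLE (N : Subgroup G) [N.Normal] (n : ℕ) :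
    ((infOpenIndexLE N n).map N.subtype).Normal := by
  refine ⟨?_⟩
  rintro _ ⟨x, hx, rfl⟩ g
  exact ⟨_, infOpenIndexLE_le_comap (conjNormalContinuousMulEquiv N g) n hx, rfl⟩

/-- An open subgroup of index at most `n` in `N` has index at most `n * N.index` in `G`. -/
theorem inf_infOpenIndexLE_le {G : Type*} [Group G] [TopologicalSpace G] (N : Subgroup G)
    (hN : IsOpen (N : Set G)) (n : ℕ) :
    infOpenIndexLE G (n * N.index) ⊓ N ≤ (infOpenIndexLE N n).map N.subtype := by
  rintro x ⟨hx, hxN⟩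
  refine ⟨⟨x, hxN⟩, Subgroup.mem_sInf.2 fun P hP => ?_, rfl⟩
  have := infOpenIndexLE_le (P := P.map N.subtype) (n := n * N.index)
    (hN.isOpenMap_subtype_val _ hP.1)
    (by rw [Subgroup.index_map_subtype]; exact Nat.mul_le_mul_right _ hP.2) hx
  obtain ⟨y, hy, rfl⟩ := this
  exact hy

theorem relIndex_map_infOpenIndexLE {G : Type*} [Group G] [TopologicalSpace G] (N : Subgroup G)
    (n : ℕ) :
    ((infOpenIndexLE N n).map N.subtype).relIndex N = (infOpenIndexLE N n).index := by
  rw [Subgroup.relIndex, Subgroup.subgroupOf,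
    Subgroup.comap_map_eq_self_of_injective N.subtype_injective]

/-- `G` acts by conjugation on the image of `N` in `G ⧸ D`. The kernel of this action has index
bounded in terms of the order `c` of this image only, and is open because it contains `D`. -/
theorem commutator_mem_of_mem_infOpenIndexLE {N D : Subgroup G} [N.Normal] [D.Normal]
    (hD : IsOpen (D : Set G)) {c : ℕ} (hc : D.relIndex N = c) (hc0 : c ≠ 0)
    {g x : G} (hg : g ∈ infOpenIndexLE G (c ^ c)) (hx : x ∈ N) : g * x * g⁻¹ * x⁻¹ ∈ D := by
  set Q := N.map (QuotientGroup.mk' D) with hQ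
  have hQn : Q.Normal := Subgroup.Normal.map inferInstance _ (QuotientGroup.mk'_surjective D)
  -- `Q` is the image of `N` in `G ⧸ D`, a finite normal subgroup.
  have hcard : Nat.card Q = c := by
    rw [hQ, ← Subgroup.relIndex_ker, QuotientGroup.ker_mk', hc]
  have hfin : Finite Q := Nat.finite_of_card_ne_zero (hcard ▸ hc0)
  let φ : G →* MulAut Q := MulAut.conjNormal.comp (QuotientGroup.mk' D)
  have hDφ : D ≤ φ.ker := by
    intro d hd
    have : QuotientGroup.mk' D d = 1 := (QuotientGroup.eq_one_iff d).2 hd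
    rw [MonoidHom.mem_ker, MonoidHom.comp_apply, this, map_one]
  have hindex : φ.ker.index ≤ c ^ c := by
    -- There are at most `c ^ c` self-maps of `Q`.
    rw [Subgroup.index_ker, ← hcard, ← Nat.card_fun]
    exact Nat.card_le_card_of_injective (fun f : φ.range => ((f : MulAut Q) : Q → Q))
      fun a b h => Subtype.ext (DFunLike.coe_injective h)
  have hgφ : φ g = 1 :=
    infOpenIndexLE_le (Subgroup.isOpen_mono hDφ hD) hindex hg
  have := congrArg Subtype.val (DFunLike.congr_fun hgφ ⟨QuotientGroup.mk' D x, ⟨x, hx, rfl⟩⟩)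
  simp only [φ, MonoidHom.comp_apply, MulAut.conjNormal_apply, MulAut.one_apply] at this
  rw [← QuotientGroup.eq_one_iff]
  rw [← mul_inv_eq_one] at this
  exact this

variable [CompactSpace G]

theorem IsJustInfinite.finite_openNormalSubgroup_not_le (hG : IsJustInfinite G) {H : Subgroup G}
    (hH : IsOpen (H : Set G)) : {N : OpenNormalSubgroup G | ¬ N.toSubgroup ≤ H}.Finite :=
  ((hG.finite_not_le hH).preimage OpenNormalSubgroup.toSubgroup_injective.injOn).subset
    fun N hN => ⟨N.isNormal', N.toSubgroup.isClosed_of_isOpen N.isOpen, hN⟩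

variable [TotallyDisconnectedSpace G]

/-- An open subgroup of index at most `m` has a normal core of index at most `m!`, and such a core
is not contained in an open subgroup of larger index. So only finitely many cores occur. -/
theorem IsJustInfinite.isOpen_infOpenIndexLE (hG : IsJustInfinite G) (m : ℕ) :
    IsOpen (infOpenIndexLE G m : Set G) := by
  have := hG.1
  obtain ⟨U, hU⟩ := exists_openNormalSubgroup_lt_index (G := G) m.factorial
  have hfin := (hG.finite_not_le U.isOpen).subset
    (t := {P : Subgroup G | IsOpen (P : Set G) ∧ P.Normal ∧ ¬ P ≤ U.toSubgroup})
    fun P hP => ⟨hP.2.1, P.isClosed_of_isOpen hP.1, hP.2.2⟩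
  refine Subgroup.isOpen_mono (H₁ := sInf {P : Subgroup G | IsOpen (P : Set G) ∧ P.Normal ∧
    ¬ P ≤ U.toSubgroup}) (le_sInf fun P hP => ?_) ?_
  · have := Subgroup.finiteIndex_of_isOpen hP.1
    have hcore := Subgroup.isOpen_normalCore hP.1
    have := Subgroup.finiteIndex_of_isOpen hcore
    refine le_trans (sInf_le (a := P.normalCore) ⟨hcore, inferInstance, fun h => ?_⟩)
      P.normalCore_le
    exact hU.not_ge ((Subgroup.index_antitone h).trans
      (P.index_normalCore_le.trans (Nat.factorial_le hP.2)))
  · rw [Subgroup.coe_sInf]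
    exact hfin.isOpen_biInter fun P hP => hP.1

theorem IsJustInfinite.isOpen_map_infOpenIndexLE (hG : IsJustInfinite G) {N : Subgroup G}
    (hN : IsOpen (N : Set G)) (n : ℕ) :
    IsOpen ((infOpenIndexLE N n).map N.subtype : Set G) := by
  refine Subgroup.isOpen_mono (inf_infOpenIndexLE_le N hN n) ?_
  rw [Subgroup.coe_inf]
  exact (hG.isOpen_infOpenIndexLE _).inter hN

theorem infinite_openNormalSubgroup [Infinite G] : Infinite (OpenNormalSubgroup G) := by
  by_contra h
  rw [not_infinite_iff_finite] at h
  obtain ⟨m, hm⟩ := (Set.finite_range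
    fun N : OpenNormalSubgroup G => N.toSubgroup.index).bddAbove
  obtain ⟨U, hU⟩ := exists_openNormalSubgroup_lt_index (G := G) m
  exact hU.not_ge (hm ⟨U, rfl⟩)

theorem eq_one_of_forall_mem_infOpenIndexLE {N : Subgroup G} {x : N}
    (h : ∀ n, x ∈ infOpenIndexLE N n) : x = 1 := by
  by_contra hx
  obtain ⟨U, hU⟩ := exists_openNormalSubgroup_notMem (x := (x : G)) (by simpa using hx)
  -- `n` is the index of `U ∩ N` in `N`.
  exact hU (infOpenIndexLE_le (P := U.toSubgroup.subgroupOf N)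
    (U.isOpen.preimage continuous_subtype_val) le_rfl (h _))

/-- Let infinitely many open normal subgroups be isomorphic to each other. For given `n`, each
member `N` is centralised modulo `infOpenIndexLE N n` by one and the same open subgroup `E` of `G`.
Some member is contained in `E`, hence is abelian modulo its `infOpenIndexLE`. As this is a property
of the isomorphism type and `n` is arbitrary, all members are abelian. -/
theorem IsJustInfinite.commute_of_infinite_class (hG : IsJustInfinite G)
    {S : Set (OpenNormalSubgroup G)} (hS : S.Infinite)
    (hiso : ∀ M ∈ S, ∀ N ∈ S, Nonempty (M.toSubgroup ≃ₜ* N.toSubgroup))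
    {N : OpenNormalSubgroup G} (hN : N ∈ S) (x y : N.toSubgroup) : x * y = y * x := by
  rw [← mul_inv_eq_one, mul_inv_rev, ← mul_assoc]
  refine eq_one_of_forall_mem_infOpenIndexLE fun n => ?_
  set c := (infOpenIndexLE N.toSubgroup n).index with hc
  obtain ⟨M, hMS, hME⟩ : ∃ M ∈ S, M.toSubgroup ≤ infOpenIndexLE G (c ^ c) := by
    by_contra! h
    exact hS ((hG.finite_openNormalSubgroup_not_le (hG.isOpen_infOpenIndexLE (c ^ c))).subset h)
  obtain ⟨e⟩ := hiso N hN M hMS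
  rw [← comap_infOpenIndexLE e]
  have hDo := hG.isOpen_map_infOpenIndexLE M.isOpen n
  have hcM := relIndex_map_infOpenIndexLE M.toSubgroup n
  rw [← index_infOpenIndexLE_congr e, ← hc] at hcM
  have hc0 : c ≠ 0 := by
    have := Subgroup.finiteIndex_of_isOpen hDo
    rw [← hcM]
    exact ne_zero_of_dvd_ne_zero this.index_ne_zero (Subgroup.relIndex_dvd_index_of_normal _ _)
  obtain ⟨z, hz, hzeq⟩ := commutator_mem_of_mem_infOpenIndexLE hDo hcM hc0 (hME (e x).2) (e y).2
  have : z = e (x * y * x⁻¹ * y⁻¹) := by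
    apply Subtype.ext
    simpa using hzeq
  exact (congrArg (· ∈ infOpenIndexLE M.toSubgroup n) this).mp hz

theorem IsJustInfinite.isVirtuallyAbelian_of_finite (hG : IsJustInfinite G)
    [Finite (OpenNormalIsoType G)] : IsVirtuallyAbelian G := by
  have := hG.1
  have := infinite_openNormalSubgroup (G := G)
  obtain ⟨q, hq⟩ := Finite.exists_infinite_fiber
    (Quotient.mk (openNormalIsoSetoid G))
  have hS := Set.infinite_coe_iff.1 hq
  obtain ⟨N, hN⟩ := hS.nonempty
  refine ⟨N.toSubgroup, N.toSubgroup.isClosed_of_isOpen N.isOpen,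
    Subgroup.finiteIndex_of_isOpen N.isOpen, fun x hx y hy => ?_⟩
  have := hG.commute_of_infinite_class hS
    (fun M hM N hN => Quotient.exact (Eq.trans hM (Eq.symm hN))) hN ⟨x, hx⟩ ⟨y, hy⟩
  exact congrArg Subtype.val this

end OpenIndexLE

/-! ### The virtually abelian case -/

section VirtuallyAbelian

theorem Subgroup.finite_conjugatesOf {G : Type*} [Group G] (A : Subgroup G) [A.FiniteIndex]
    {a : G} (ha : ∀ x ∈ A, x * a = a * x) : (conjugatesOf a).Finite := by
  let f : G ⧸ A → G := Quotient.lift (fun g : G => g * a * g⁻¹) (by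
    intro g h hgh
    have := ha _ (QuotientGroup.leftRel_apply.1 hgh)
    calc g * a * g⁻¹ = g * (a * (g⁻¹ * h)) * h⁻¹ := by group
      _ = h * a * h⁻¹ := by rw [← this]; group)
  refine (Set.finite_range f).subset fun b hb => ?_
  obtain ⟨g, hg⟩ := isConj_iff.1 (show IsConj a b from hb)
  exact ⟨QuotientGroup.mk g, hg⟩

/-- A torsion element of an abelian normal subgroup of finite index has finitely many conjugates,
and these generate a finitely generated abelian torsion group. -/
theorem Subgroup.finite_normalClosure_of_pow_eq_one {G : Type*} [Group G] (A : Subgroup G)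
    [A.Normal] [A.FiniteIndex] (hA : ∀ x ∈ A, ∀ y ∈ A, x * y = y * x) {a : G} (ha : a ∈ A)
    {n : ℕ} (hn : 0 < n) (han : a ^ n = 1) : Finite (Subgroup.normalClosure {a}) := by
  have hle : Subgroup.normalClosure {a} ≤ A :=
    Subgroup.normalClosure_le_normal (by simpa using ha)
  let _ : CommGroup (Subgroup.normalClosure {a}) :=
    { (inferInstance : Group (Subgroup.normalClosure {a})) with
      mul_comm := fun x y => Subtype.ext (hA _ (hle x.2) _ (hle y.2)) }
  have hfg : Group.FG (Subgroup.normalClosure {a}) := by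
    rw [Group.fg_iff_subgroup_fg, Subgroup.fg_iff]
    refine ⟨_, rfl, ?_⟩
    rw [Group.conjugatesOfSet]
    exact (Set.finite_singleton a).biUnion fun b hb => A.finite_conjugatesOf
      fun x hx => hA x hx b (by rwa [Set.mem_singleton_iff.1 hb])
  refine CommGroup.finite_of_fg_isMulTorsion _ fun x => ?_
  refine isOfFinOrder_iff_pow_eq_one.2 ⟨n, hn, Subtype.ext ?_⟩
  let T : Subgroup G :=
    { carrier := {x | x ∈ A ∧ x ^ n = 1}
      one_mem' := ⟨A.one_mem, one_pow n⟩
      mul_mem' := fun {x y} hx hy => ⟨A.mul_mem hx.1 hy.1, by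
        rw [Commute.mul_pow (hA x hx.1 y hy.1), hx.2, hy.2, one_mul]⟩
      inv_mem' := fun {x} hx => ⟨A.inv_mem hx.1, by rw [inv_pow, hx.2, inv_one]⟩ }
  have hT : T.Normal := ⟨fun x hx g => ⟨Subgroup.Normal.conj_mem inferInstance x hx.1 g, by
    rw [conj_pow, hx.2, mul_one, mul_inv_cancel]⟩⟩
  exact (Subgroup.normalClosure_le_normal (N := T) (by simpa using ⟨ha, han⟩) x.2).2

/-- The subgroup of `m`-th powers of the elements of an abelian subgroup. -/
def Subgroup.powers {G : Type*} [Group G] (A : Subgroup G)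
    (hA : ∀ x ∈ A, ∀ y ∈ A, x * y = y * x) (m : ℕ) : Subgroup G where
  carrier := (· ^ m) '' (A : Set G)
  one_mem' := ⟨1, A.one_mem, one_pow m⟩
  mul_mem' := by
    rintro _ _ ⟨x, hx, rfl⟩ ⟨y, hy, rfl⟩
    exact ⟨x * y, A.mul_mem hx hy, Commute.mul_pow (hA x hx y hy) m⟩
  inv_mem' := by
    rintro _ ⟨x, hx, rfl⟩
    exact ⟨x⁻¹, A.inv_mem hx, inv_pow x m⟩

/-- The elements of an abelian subgroup `A` whose `m`-th power lies in `N`. -/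
def Subgroup.roots {G : Type*} [Group G] (A : Subgroup G)
    (hA : ∀ x ∈ A, ∀ y ∈ A, x * y = y * x) (m : ℕ) (N : Subgroup G) : Subgroup G where
  carrier := A ∩ (· ^ m) ⁻¹' N
  one_mem' := ⟨A.one_mem, by simp⟩
  mul_mem' := by
    rintro x y ⟨hx, hxN⟩ ⟨hy, hyN⟩
    refine ⟨A.mul_mem hx hy, ?_⟩
    have := N.mul_mem hxN hyN
    rwa [← Commute.mul_pow (hA x hx y hy)] at this
  inv_mem' := by
    rintro x ⟨hx, hxN⟩
    refine ⟨A.inv_mem hx, ?_⟩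
    have := N.inv_mem hxN
    rwa [← inv_pow] at this

section Algebra

variable {G : Type*} [Group G] {A : Subgroup G} (hA : ∀ x ∈ A, ∀ y ∈ A, x * y = y * x)

theorem Subgroup.normal_powers [A.Normal] (m : ℕ) : (A.powers hA m).Normal := by
  refine ⟨?_⟩
  rintro _ ⟨x, hx, rfl⟩ g
  exact ⟨g * x * g⁻¹, Subgroup.Normal.conj_mem inferInstance x hx g, conj_pow⟩

theorem Subgroup.normal_roots [A.Normal] (m : ℕ) (N : Subgroup G) [N.Normal] :
    (A.roots hA m N).Normal := by
  refine ⟨?_⟩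
  rintro x ⟨hx, hxN⟩ g
  refine ⟨Subgroup.Normal.conj_mem inferInstance x hx g, ?_⟩
  have := Subgroup.Normal.conj_mem inferInstance _ hxN g
  rwa [← conj_pow] at this

theorem Subgroup.pow_injOn_of_torsionFree {G : Type*} [Group G] {A : Subgroup G}
    (hA : ∀ x ∈ A, ∀ y ∈ A, x * y = y * x) (htf : ∀ a ∈ A, ∀ n, 0 < n → a ^ n = 1 → a = 1) {m : ℕ}
    (hm : 0 < m) {x y : G} (hx : x ∈ A) (hy : y ∈ A) (h : x ^ m = y ^ m) : x = y := by
  rw [← mul_inv_eq_one]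
  refine htf _ (A.mul_mem hx (A.inv_mem hy)) m hm ?_
  rw [Commute.mul_pow (hA x hx _ (A.inv_mem hy)), h, inv_pow, mul_inv_cancel]

end Algebra

theorem IsJustInfinite.eq_one_of_pow_eq_one {G : Type*} [Group G] [TopologicalSpace G] [T1Space G]
    (hG : IsJustInfinite G) {A : Subgroup G}
    [A.Normal] [A.FiniteIndex] (hA : ∀ x ∈ A, ∀ y ∈ A, x * y = y * x) {a : G} (ha : a ∈ A)
    {n : ℕ} (hn : 0 < n) (han : a ^ n = 1) : a = 1 := by
  have hfin := A.finite_normalClosure_of_pow_eq_one hA ha hn han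
  have hmem : a ∈ Subgroup.normalClosure {a} := Subgroup.subset_normalClosure rfl
  by_contra hne
  have hidx := hG.2 (Subgroup.normalClosure {a}) inferInstance
    (Set.toFinite _).isClosed (fun h => hne (by rwa [h, Subgroup.mem_bot] at hmem))
  have := hG.1
  have hcard := Subgroup.card_mul_index (Subgroup.normalClosure {a})
  rw [Nat.card_eq_zero_of_infinite (α := G)] at hcard
  exact mul_ne_zero Nat.card_pos.ne' hidx.index_ne_zero hcard

variable {G : Type*} [Group G] [TopologicalSpace G] [IsTopologicalGroup G] [CompactSpace G]

/-- If `N` consists of `m`-th powers of elements of the torsion-free abelian group `A`, then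
raising to the `m`-th power is an isomorphism onto `N`. -/
theorem Subgroup.nonempty_roots_continuousMulEquiv [T2Space G] {A : Subgroup G}
    (hA : ∀ x ∈ A, ∀ y ∈ A, x * y = y * x) (htf : ∀ a ∈ A, ∀ n, 0 < n → a ^ n = 1 → a = 1)
    (hAc : IsClosed (A : Set G)) {N : Subgroup G} (hN : IsClosed (N : Set G)) {m : ℕ}
    (hm : 0 < m) (hNA : N ≤ A.powers hA m) : Nonempty (A.roots hA m N ≃ₜ* N) := by
  let f : A.roots hA m N →* N :=
    { toFun := fun x => ⟨(x : G) ^ m, x.2.2⟩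
      map_one' := Subtype.ext (one_pow m)
      map_mul' := fun x y => Subtype.ext (Commute.mul_pow (hA x x.2.1 y y.2.1) m) }
  have hf : Function.Bijective f := by
    refine ⟨fun x y h => Subtype.ext ?_, fun y => ?_⟩
    · exact Subgroup.pow_injOn_of_torsionFree hA htf hm x.2.1 y.2.1 (congrArg Subtype.val h)
    · obtain ⟨x, hx, hxy⟩ := hNA y.2
      exact ⟨⟨x, hx, show x ^ m ∈ N from (show x ^ m = y from hxy) ▸ y.2⟩, Subtype.ext hxy⟩
  have hcont : Continuous f := Continuous.subtype_mk (by fun_prop) _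
  have hclosed : IsClosed (A.roots hA m N : Set G) :=
    hAc.inter (hN.preimage (continuous_pow m))
  have : CompactSpace (A.roots hA m N) := isCompact_iff_compactSpace.1 hclosed.isCompact
  let e := MulEquiv.ofBijective f hf
  exact ⟨{ e with
    continuous_toFun := hcont
    continuous_invFun :=
      (Continuous.homeoOfEquivCompactToT2 (f := e.toEquiv) hcont).symm.continuous }⟩

variable [TotallyDisconnectedSpace G]

/-- For some `n`, the open subgroup `A` has an element that is not an `n`-th power, even in `G`:
take the index `n` of an open normal subgroup not containing `A`. -/
theorem exists_mem_forall_pow_ne [Infinite G] {A : Subgroup G} (hA : IsOpen (A : Set G)) :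
    ∃ n, 0 < n ∧ ∃ a ∈ A, ∀ x : G, x ^ n ≠ a := by
  obtain ⟨a, ha, hne⟩ : ∃ a ∈ A, a ≠ 1 := by
    by_contra! h
    exact not_isOpen_bot_of_infinite ((A.eq_bot_iff_forall.2 h) ▸ hA)
  obtain ⟨U, hU⟩ := exists_openNormalSubgroup_notMem hne
  have := Subgroup.finiteIndex_of_isOpen U.isOpen
  exact ⟨U.toSubgroup.index, Nat.pos_of_ne_zero this.index_ne_zero, a, ha,
    fun x hx => hU (hx ▸ U.toSubgroup.pow_index_mem x)⟩

/-- The subgroups of `n ^ k`-th powers are pairwise distinct. Were they all to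
contain `N ≠ ⊥`, their intersection would have finite index. -/
theorem IsJustInfinite.exists_not_le_powers (hG : IsJustInfinite G) {A : Subgroup G} [A.Normal]
    (hAo : IsOpen (A : Set G)) (hA : ∀ x ∈ A, ∀ y ∈ A, x * y = y * x)
    (htf : ∀ a ∈ A, ∀ n, 0 < n → a ^ n = 1 → a = 1) {n : ℕ} (hn : 0 < n) {a : G} (ha : a ∈ A)
    (hna : ∀ x : G, x ^ n ≠ a) {N : Subgroup G} (hN : N ≠ ⊥) :
    ∃ k, ¬ N ≤ A.powers hA (n ^ k) := by
  by_contra! hle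
  have hfin : (⨅ k, A.powers hA (n ^ k)).FiniteIndex := by
    refine hG.2 _ (Subgroup.normal_iInf_normal fun k => Subgroup.normal_powers hA _) ?_ ?_
    · rw [Subgroup.coe_iInf]
      exact isClosed_iInter fun k => (((A.isClosed_of_isOpen hAo).isCompact).image
        (continuous_pow (n ^ k))).isClosed
    · exact fun h => hN (le_bot_iff.1 (h ▸ le_iInf hle))
  refine Set.infinite_range_of_injective (f := fun k => A.powers hA (n ^ k)) ?_
    ((Subgroup.finite_setOf_ge_of_finiteIndex _).subset
      (Set.range_subset_iff.2 fun i => iInf_le (fun k => A.powers hA (n ^ k)) i))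
  refine Function.Injective.of_lt_imp_ne fun i j hij h => ?_
  have hmem : a ^ n ^ i ∈ A.powers hA (n ^ i) := ⟨a, ha, rfl⟩
  rw [show A.powers hA (n ^ i) = A.powers hA (n ^ j) from h] at hmem
  obtain ⟨b, hb, hba⟩ := hmem
  obtain ⟨d, rfl⟩ := Nat.exists_eq_add_of_lt hij
  -- `a` and `b ^ n ^ (d + 1)` have the same `n ^ i`-th power, so `a` would be an `n`-th power.
  refine hna (b ^ n ^ d) ?_
  refine Subgroup.pow_injOn_of_torsionFree hA htf (Nat.pow_pos hn) (m := n ^ i)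
    (A.pow_mem (A.pow_mem hb _) _) ha ?_
  rw [← hba, ← pow_mul, ← pow_mul]
  congr 1
  ring

/-- Let `A` be open, normal, abelian, and hence torsion-free, and choose `n` with `A ^ n ≠ A`. An
open normal subgroup `N ≤ A` lies in `A ^ (n ^ k)` for a largest `k`. It is isomorphic to the group
of its `n ^ k`-th roots in `A`, which is open, normal and not contained in `A ^ n`; only finitely
many subgroups of this kind exist. -/
theorem IsJustInfinite.finite_of_isVirtuallyAbelian (hG : IsJustInfinite G)
    (h : IsVirtuallyAbelian G) : Finite (OpenNormalIsoType G) := by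
  have := hG.1
  obtain ⟨B, hBc, hBfin, hB⟩ := h
  set A := B.normalCore with hAdef
  have hAo : IsOpen (A : Set G) :=
    Subgroup.isOpen_normalCore (B.isOpen_of_isClosed_of_finiteIndex hBc)
  have hAc := A.isClosed_of_isOpen hAo
  have hA : ∀ x ∈ A, ∀ y ∈ A, x * y = y * x := fun x hx y hy =>
    hB x (B.normalCore_le hx) y (B.normalCore_le hy)
  have htf : ∀ a ∈ A, ∀ n, 0 < n → a ^ n = 1 → a = 1 := fun a ha n hn =>
    hG.eq_one_of_pow_eq_one hA ha hn
  obtain ⟨n, hn, a, ha, hna⟩ := exists_mem_forall_pow_ne hAo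
  have hPo : IsOpen (A.powers hA n : Set G) := by
    refine hG.isOpen (Subgroup.normal_powers hA n)
      (hAc.isCompact.image (continuous_pow n)).isClosed fun h => ?_
    have h1 : a ^ n = 1 := by
      rw [← Subgroup.mem_bot, ← h]
      exact ⟨a, ha, rfl⟩
    exact hna 1 (by rw [one_pow, htf a ha n hn h1])
  have hfin := hG.finite_openNormalSubgroup_not_le hPo
  have := hfin.to_subtype
  refine Finite.of_surjective (fun N : {N : OpenNormalSubgroup G | ¬ N.toSubgroup ≤
    A.powers hA n} => (Quotient.mk (openNormalIsoSetoid G) N.1 : OpenNormalIsoType G)) ?_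
  intro q
  obtain ⟨N, rfl⟩ := Quotient.exists_rep q
  by_cases hNP : N.toSubgroup ≤ A.powers hA n
  swap
  · exact ⟨⟨N, hNP⟩, rfl⟩
  classical
  have hex := hG.exists_not_le_powers hAo hA htf hn ha hna (hG.ne_bot_of_isOpen N.isOpen)
  obtain ⟨k, hk⟩ : ∃ k, Nat.find hex = k + 1 := by
    refine Nat.exists_eq_succ_of_ne_zero fun h0 => Nat.find_spec hex ?_
    rw [h0, pow_zero]
    rintro x hx
    obtain ⟨y, hy, rfl⟩ := hNP hx
    exact ⟨y ^ n, A.pow_mem hy n, pow_one _⟩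
  have hkle : N.toSubgroup ≤ A.powers hA (n ^ k) :=
    not_not.1 (Nat.find_min hex (hk ▸ Nat.lt_succ_self k))
  have hknot : ¬ N.toSubgroup ≤ A.powers hA (n ^ (k + 1)) := hk ▸ Nat.find_spec hex
  have hNn : N.toSubgroup.Normal := N.isNormal'
  let M : OpenNormalSubgroup G :=
    { toSubgroup := A.roots hA (n ^ k) N.toSubgroup
      isOpen' := hAo.inter (N.isOpen.preimage (continuous_pow _))
      isNormal' := Subgroup.normal_roots hA _ _ }
  refine ⟨⟨M, fun hM => hknot fun x hx => ?_⟩, Quotient.sound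
    (Subgroup.nonempty_roots_continuousMulEquiv hA htf hAc
      (N.toSubgroup.isClosed_of_isOpen N.isOpen) (Nat.pow_pos hn) hkle)⟩
  obtain ⟨y, hy, rfl⟩ := hkle hx
  obtain ⟨z, hz, rfl⟩ := hM (show y ∈ M.toSubgroup from ⟨hy, hx⟩)
  exact ⟨z, hz, by simp only [← pow_mul, pow_succ']⟩

end VirtuallyAbelian

/-! ### Isomorphism types of open normal subgroups -/

theorem mainTheorem8 (G : Type*) [Group G] [TopologicalSpace G] [IsTopologicalGroup G]
    [CompactSpace G] [T2Space G] [TotallyDisconnectedSpace G] (hG : IsJustInfinite G) :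
    Infinite (OpenNormalIsoType G) ↔ ¬ IsVirtuallyAbelian G := by
  rw [← not_finite_iff_infinite, not_iff_not]
  exact ⟨fun _ => hG.isVirtuallyAbelian_of_finite, hG.finite_of_isVirtuallyAbelian⟩
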